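/- Let $(\mathcal J,\circ)$ be a finite-dimensional Euclidean Jordan algebra over $\mathbb R$ with identity $e$: the product $\circ$ is bilinear and commutative, $x^2\circ(x\circ y)=x\circ(x^2\circ y)$, and there is an inner product $(\cdot,\cdot)$ on $\mathcal J$ with $(x\circ y,z)=(y,x\circ z)$. Every $x\in\mathcal J$ has a spectral decomposition $x=\sum_{k}\lambda_k c_k$ over a Jordan frame $(c_k)$, that is, a family of primitive idempotents with $c_k\circ c_l=0$ for $k\ne l$ and $\sum_k c_k=e$; put $\operatorname{tr}(x)=\sum_k\lambda_k$, $\langle x,y\rangle=\operatorname{tr}(x\circ y)$ and $x^p=\sum_k\lambda_k^p c_k$ whenever all $\lambda_k^p$ are defined. Let $\mathcal K=\{x^2:x\in\mathcal J\}$ be the associated symmetric cone, $L(x)y=x\circ y$, $P(x)=2L(x)^2-L(x^2)$, and, for $x,y\in\operatorname{int}(\mathcal K)$, $$x\#y=P(x^{1/2})\bigl(P(x^{-1/2})y\bigr)^{1/2}.$$ Let $X\in\mathbb R^{m\times n}$ (in particular, $X$ may be any entrywise non-negative matrix), with rows $X_{i:}$ and columns $X_{:j}$, and let $a_1,\dots,a_m,b_1,\dots,b_n\in\operatorname{int}(\mathcal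 K)$. Define $\mathcal A x=(\langle a_1,x\rangle,\dots,\langle a_m,x\rangle)$ and $\mathcal B x=(\langle b_1,x\rangle,\dots,\langle b_n,x\rangle)$ for $x\in\mathcal J$, with adjoints $\mathcal A^{\sf T}y=\sum_i y_ia_i$ and $\mathcal B^{\sf T}z=\sum_j z_jb_j$. Suppose that the $a_i$ and $b_j$ are a fixed point of the symmetric-cone multiplicative updates for $X$, i.e. $$a_i=P\bigl(a_i\#(\mathcal B^{\sf T}\mathcal B a_i)^{-1}\bigr)\mathcal B^{\sf T}X_{i:}\quad(1\le i\le m),\qquad b_j=P\bigl(b_j\#(\mathcal A^{\sf T}\mathcal A b_j)^{-1}\bigr)\mathcal A^{\sf T}X_{:j}\quad(1\le j\le n).$$ Then $$\mathcal B^{\sf T}X_{i:}=\mathcal B^{\sf T}\mathcal B a_i\quad(1\le i\le m)\qquad\text{and}\qquad \mathcal A^{\sf T}X_{:j}=\mathcal A^{\sf T}\mathcal A b_j\quad(1\le j\le n).$$ In other words, $(a_i),(b_j)$ is a first-order stationary point of the squared loss $\sum_{i,j}\bigl(X_{ij}-\langle a_i,b_j\rangle\bigr)^2$: all its directional derivatives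 at this point vanish. -/

import Mathlib

namespace SCMU

/-- A real Jordan algebra is Euclidean if it carries an associative inner product, i.e. a
symmetric positive definite bilinear form `φ` with `φ (x ∘ y) z = φ y (x ∘ z)`.
The Jordan product `x ∘ y` is written `x * y`. -/
class IsEuclidean (J : Type*) [NonAssocCommRing J] [Module ℝ J] : Prop where
  exists_assoc_inner : ∃ φ : LinearMap.BilinForm ℝ J,
    (∀ x y, φ x y = φ y x) ∧ (∀ x, x ≠ 0 → 0 < φ x x) ∧
      (∀ x y z, φ (x * y) z = φ y (x * z))

section Algebra

variable {J : Type*} [NonAssocCommRing J] [Module ℝ J]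

/-- A primitive idempotent: a nonzero idempotent that is not the sum of two nonzero idempotents. -/
def IsPrimitiveIdempotent (c : J) : Prop :=
  c ≠ 0 ∧ c * c = c ∧
    ¬ ∃ u v : J, u ≠ 0 ∧ v ≠ 0 ∧ u * u = u ∧ v * v = v ∧ c = u + v

/-- A Jordan frame: pairwise orthogonal primitive idempotents which sum to the identity. -/
structure IsJordanFrame {r : ℕ} (c : Fin r → J) : Prop where
  primitive : ∀ i, IsPrimitiveIdempotent (c i)
  mul_eq_zero_iff : ∀ i j, c i * c j = 0 ↔ i ≠ j
  sum_eq_one : ∑ i, c i = 1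

/-- A spectral decomposition `x = ∑ λᵢ cᵢ` of `x` over a Jordan frame. -/
structure SpectralDecomposition (x : J) where
  rank : ℕ
  frame : Fin rank → J
  eigenvalue : Fin rank → ℝ
  isJordanFrame : IsJordanFrame frame
  eq_sum : x = ∑ i, eigenvalue i • frame i

open Classical in
/-- The trace: the sum of the eigenvalues. (In a Euclidean Jordan algebra every element has a
spectral decomposition, and the value does not depend on the one that is chosen.) -/
noncomputable def trace (x : J) : ℝ :=
  if h : Nonempty (SpectralDecomposition x) then ∑ i, h.some.eigenvalue i else 0

open Classical in
/-- The power `x ^ p = ∑ λᵢ ^ p cᵢ`, for real `p`. It is used below for elements of the interior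
of the cone of squares, all of whose eigenvalues are positive. (In a Euclidean Jordan algebra the
value does not depend on the spectral decomposition that is chosen.) -/
noncomputable def power (x : J) (p : ℝ) : J :=
  if h : Nonempty (SpectralDecomposition x) then
    ∑ i, (h.some.eigenvalue i ^ p) • h.some.frame i
  else 0

/-- The canonical inner product `⟨x, y⟩ = tr (x ∘ y)`. -/
noncomputable def traceInner (x y : J) : ℝ := trace (x * y)

/-- The cone of squares. -/
def coneOfSquares (J : Type*) [NonAssocCommRing J] : Set J := {y | ∃ x : J, y = x * x}

/-- The linear map `𝒜 x = (⟨a₁, x⟩, …, ⟨a_m, x⟩)` attached to a family `a`. -/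
noncomputable def coneMap {m : ℕ} (a : Fin m → J) (x : J) : Fin m → ℝ :=
  fun i => traceInner (a i) x

/-- The transpose `𝒜ᵀ y = ∑ yᵢ aᵢ` of `coneMap a`, i.e. its adjoint with respect to the canonical
inner product and the standard inner product of `ℝᵐ`. -/
def coneMapTranspose {m : ℕ} (a : Fin m → J) (y : Fin m → ℝ) : J :=
  ∑ i, y i • a i

/-- The squared loss `∑ᵢⱼ (Xᵢⱼ - ⟨aᵢ, bⱼ⟩)²`. -/
noncomputable def squaredLoss {m n : ℕ} (X : Matrix (Fin m) (Fin n) ℝ)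
    (a : Fin m → J) (b : Fin n → J) : ℝ :=
  ∑ i, ∑ j, (X i j - traceInner (a i) (b j)) ^ 2

variable [SMulCommClass ℝ J J]

/-- The quadratic representation `P(x) = 2 L(x)² - L(x²)`, where `L(x) y = x ∘ y`. -/
noncomputable def quadRep (x : J) : Module.End ℝ J :=
  (2 : ℝ) • (LinearMap.mulLeft ℝ x) ^ 2 - LinearMap.mulLeft ℝ (x * x)

/-- The metric geometric mean `x # y = P(x^{1/2}) (P(x^{-1/2}) y)^{1/2}`. -/
noncomputable def geomMean (x y : J) : J :=
  quadRep (power x (1 / 2)) (power (quadRep (power x (-1 / 2)) y) (1 / 2))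

/-- One multiplicative update `v ↦ P(v # (𝒜ᵀ 𝒜 v)⁻¹) 𝒜ᵀ x` of the factor `v`, where `𝒜` is
attached to the family `a` of fixed factors, and `x` is the data vector. -/
noncomputable def update {m : ℕ} (a : Fin m → J) (x : Fin m → ℝ) (v : J) : J :=
  quadRep (geomMean v (power (coneMapTranspose a (coneMap a v)) (-1))) (coneMapTranspose a x)

/-- The factors `a`, `b` are a fixed point of the symmetric-cone multiplicative updates for `X`:
no `aᵢ` (updated with the `i`-th row of `X`) and no `bⱼ` (updated with the `j`-th column of `X`)
is changed. -/
def IsFixedPoint {m n : ℕ} (X : Matrix (Fin m) (Fin n) ℝ) (a : Fin m → J) (b : Fin n → J) :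
    Prop :=
  (∀ i, a i = update b (fun j => X i j) (a i)) ∧ (∀ j, b j = update a (fun i => X i j) (b j))

end Algebra

end SCMU

/-!
The argument rests on the equation `P(a # w⁻¹) w = a` for strictly positive `a` and `w`, which
`quadRep_geomMean` proves together with the injectivity of `P(a # w⁻¹)`. At a fixed point, `v = aᵢ`
and `w = 𝓑ᵀ𝓑v` satisfy both `P(v # w⁻¹) 𝓑ᵀXᵢ = v` and `P(v # w⁻¹) w = v`, so `𝓑ᵀXᵢ = w`; the same
holds for the `bⱼ`. The derivative of the squared loss is a sum of pairings with the differences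
`𝓑ᵀXᵢ - 𝓑ᵀ𝓑aᵢ` and `𝓐ᵀXⱼ - 𝓐ᵀ𝓐bⱼ`, so it vanishes.

The theory of Euclidean Jordan algebras needed for this is developed from an arbitrary associative
inner product `φ`, by algebraic means.

* The fundamental formula `P(P(x)y) = P(x)P(y)P(x)` (`quadRep_quadRep`) follows from the five-linear
  identity of the Jordan triple product (`tri_tri`).
* Spectral decompositions exist (`nonempty_spectralDecomposition`): `L(x)` is self-adjoint, so it is
  diagonalizable, and the components of `1` in its eigenspaces are orthogonal idempotents, which are
  then split until they are primitive.
* For primitive `c` the fundamental formula shows that non-orthogonal primitive idempotents have the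
  same length (`inner_self_eq_of_primitive`). Hence `∑ cᵢ / φ(cᵢ, cᵢ)` pairs to `1` with every
  primitive idempotent, for any Jordan frame `c`, and the trace is the pairing with this element
  (`IsJordanFrame.trace_eq`). This gives the independence of the trace from the spectral
  decomposition, its linearity, and `⟨x, y⟩ > 0` for strictly positive `x` and `y`.
* The fundamental formula also shows that `P(s)c` is a positive multiple of an idempotent if `P(s)` is
  injective (`exists_quadRep_primitive_eq_smul`), so such maps `P(s)` preserve strict positivity. This
  makes the square root inside the geometric mean a genuine one.
-/

namespace SCMU

section Triple

variable {J : Type*} [NonAssocCommRing J]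

/-! ### Linearized Jordan identities and the triple product -/

/-- The commutator `[L(a), L(b)]` of two multiplication operators. -/
def der (a b z : J) : J := a * (b * z) - b * (a * z)

theorem der_add (a b x y : J) : der a b (x + y) = der a b x + der a b y := by
  simp only [der, mul_add]; abel

theorem der_sub (a b x y : J) : der a b (x - y) = der a b x - der a b y := by
  simp only [der, mul_sub]; abel

/-- The Jordan triple product `{x y z} = (xy)z + x(yz) - y(xz)`. -/
def tri (x y z : J) : J := (x * y) * z + (x * (y * z) - y * (x * z))

theorem tri_add_left (x x' y z : J) : tri (x + x') y z = tri x y z + tri x' y z := by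
  simp only [tri, mul_add, add_mul]; abel

theorem tri_add_mid (x y y' z : J) : tri x (y + y') z = tri x y z + tri x y' z := by
  simp only [tri, mul_add, add_mul]; abel

theorem tri_sub_mid (x y y' z : J) : tri x (y - y') z = tri x y z - tri x y' z := by
  simp only [tri, mul_sub, sub_mul]; abel

theorem tri_add_right (x y z z' : J) : tri x y (z + z') = tri x y z + tri x y z' := by
  simp only [tri, mul_add]; abel

theorem tri_comm (x y z : J) : tri x y z = tri z y x := by
  simp only [tri, mul_comm]; abel

theorem tri_eq_mul_add_der (a b z : J) : tri a b z = (a * b) * z + der a b z := rfl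

theorem tri_swap (a b z : J) : tri b a z = (a * b) * z - der a b z := by
  simp only [tri, der, mul_comm]; abel

variable [Module ℝ J] [IsCommJordan J]

/-- The full linearization of the Jordan identity. Its right-hand side is symmetric in all four
variables, which is where the other identities come from. -/
theorem jordan_linearized (a b c z : J) :
    a * ((b * c) * z) + b * ((c * a) * z) + c * ((a * b) * z) =
      (b * c) * (a * z) + (c * a) * (b * z) + (a * b) * (c * z) := by
  have h := DFunLike.congr_fun (two_nsmul_lie_lmul_lmul_add_add_eq_zero a b c) z
  have h2 : (2 : ℝ) • (a * ((b * c) * z) + b * ((c * a) * z) + c * ((a * b) * z) -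
      ((b * c) * (a * z) + (c * a) * (b * z) + (a * b) * (c * z))) = 0 := by
    refine Eq.trans ?_ h
    rw [two_smul]
    change _ = 2 • ((a * ((b * c) * z) - (b * c) * (a * z)) +
      (b * ((c * a) * z) - (c * a) * (b * z)) + (c * ((a * b) * z) - (a * b) * (c * z)))
    abel
  have h3 := (smul_eq_zero.mp h2).resolve_left two_ne_zero
  exact sub_eq_zero.mp h3

theorem jordan_mul_triple (a b c z : J) :
    (b * (c * a)) * z = (b * c) * (a * z) + (c * a) * (b * z) + (a * b) * (c * z) -
      a * (b * (c * z)) - c * (b * (a * z)) := by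
  have h := jordan_linearized a z c b
  simp only [mul_comm] at h ⊢
  linear_combination (norm := abel) h

/-- Commutators of multiplication operators are derivations. -/
theorem der_mul (a b c z : J) : der a b (c * z) = der a b c * z + c * der a b z := by
  have h1 := jordan_linearized b c z a
  have h2 := jordan_linearized a c z b
  simp only [der, mul_sub, sub_mul]
  simp only [mul_comm] at h1 h2 ⊢
  linear_combination (norm := abel) h2 - h1

theorem der_tri (a b x y z : J) :
    der a b (tri x y z) = tri (der a b x) y z + tri x (der a b y) z + tri x y (der a b z) := by
  simp only [tri, der_add, der_sub, der_mul, mul_add, add_mul]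
  abel

theorem mul_tri (w x y z : J) :
    w * tri x y z = tri (w * x) y z - tri x (w * y) z + tri x y (w * z) := by
  have h1 := jordan_linearized w x y z
  have h2 := der_mul x y w z
  simp only [tri, der, mul_add, mul_sub, sub_mul] at h2 ⊢
  simp only [mul_comm] at h1 h2 ⊢
  linear_combination (norm := abel) h1 - h2

/-- The five-linear identity that makes a Jordan algebra a Jordan triple system. -/
theorem tri_tri (a b x y z : J) :
    tri a b (tri x y z) = tri (tri a b x) y z - tri x (tri b a y) z + tri x y (tri a b z) := by
  rw [tri_eq_mul_add_der a b (tri x y z), der_tri, mul_tri, tri_swap a b y,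
    tri_eq_mul_add_der a b x, tri_eq_mul_add_der a b z, tri_add_left, tri_sub_mid, tri_add_right]
  abel

/-- `{x b Q(x)y} = Q(x){b x y}` with `Q(x)y = {x y x}`. The five-linear identity exchanges `b` and
`y` up to a factor `-2`, so the difference of the two sides is killed by `3`. -/
theorem tri_tri_self (x b y : J) : tri x b (tri x y x) = tri x (tri b x y) x := by
  have h1 := tri_tri x b x y x
  have h2 := tri_tri x y x b x
  rw [tri_comm (tri x b x) y x] at h1
  rw [tri_comm (tri x y x) b x, tri_comm y x b] at h2
  have h3 : (3 : ℝ) • (tri x b (tri x y x) - tri x (tri b x y) x) = 0 := by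
    linear_combination (norm := module) -h1 - (2 : ℝ) • h2
  exact sub_eq_zero.mp ((smul_eq_zero.mp h3).resolve_left three_ne_zero)

/-- The identity `Q(y)Q(x) = 2 D(y, x)² - D(Q(y)x, x)`, where `D(a, b)z = {a b z}`. -/
theorem tri_mid_tri_self (x y z : J) :
    tri y (tri x z x) y = tri y x (tri y x z) + tri y x (tri y x z) - tri (tri y x y) x z := by
  have h := tri_tri z x y x y
  rw [tri_comm z x y, tri_comm (tri y x z) x y, tri_comm z x] at h
  linear_combination (norm := abel) h

/-- The fundamental formula `Q(Q(x)y) = Q(x)Q(y)Q(x)` for `Q(x)y = {x y x}`. -/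
theorem tri_fundamental (x y z : J) :
    tri (tri x y x) z (tri x y x) = tri x (tri y (tri x z x) y) x := by
  have h1 := tri_tri x y x z (tri x y x)
  have h2 := tri_tri_self x z y
  have h3 := tri_tri_self x y (tri y x z)
  have h4 := tri_tri_self x (tri y x z) y
  have h5 := tri_tri_self x y y
  have h6 := tri_tri_self x z (tri y x y)
  rw [tri_comm z x y] at h2
  rw [tri_comm (tri y x z) x y] at h4
  rw [h2, h3, h4, h5, h6, tri_comm z x] at h1
  rw [tri_mid_tri_self x y z, tri_sub_mid, tri_add_mid]
  linear_combination (norm := abel) -h1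

end Triple

/-! ### The quadratic representation -/

section QuadRep

variable {J : Type*} [NonAssocCommRing J] [Module ℝ J] [SMulCommClass ℝ J J]

theorem quadRep_apply (x y : J) : quadRep x y = (2 : ℝ) • (x * (x * y)) - (x * x) * y := by
  simp [quadRep, pow_two]

theorem quadRep_eq_tri (x y : J) : quadRep x y = tri x y x := by
  rw [quadRep_apply, two_smul]
  simp only [tri, mul_comm]; abel

theorem quadRep_one_right (x : J) : quadRep x 1 = x * x := by
  rw [quadRep_apply, mul_one, mul_one, two_smul, add_sub_cancel_right]

theorem quadRep_one_left (x : J) : quadRep 1 x = x := by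
  rw [quadRep_apply, one_mul, one_mul, one_mul, one_mul, two_smul, add_sub_cancel_right]

variable [IsCommJordan J]

theorem quadRep_quadRep (x y z : J) :
    quadRep (quadRep x y) z = quadRep x (quadRep y (quadRep x z)) := by
  simp only [quadRep_eq_tri, tri_fundamental]

theorem quadRep_mul_self (x z : J) : quadRep (x * x) z = quadRep x (quadRep x z) := by
  have h := quadRep_quadRep x 1 z
  rwa [quadRep_one_right, quadRep_one_left] at h

end QuadRep

/-! ### Associative inner products and the Peirce decomposition -/

/-- A positive definite symmetric bilinear form for which all multiplications are self-adjoint. -/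
structure IsAssocInner {J : Type*} [NonAssocCommRing J] [Module ℝ J]
    (φ : LinearMap.BilinForm ℝ J) : Prop where
  symm : ∀ x y, φ x y = φ y x
  pos : ∀ x, x ≠ 0 → 0 < φ x x
  assoc : ∀ x y z, φ (x * y) z = φ y (x * z)

section Peirce

variable {J : Type*} [NonAssocCommRing J] [Module ℝ J] [IsCommJordan J]

theorem commute_of_mul_eq_self {c x : J} (hc : c * c = c) (hx : c * x = x) (z : J) :
    c * (x * z) = x * (c * z) := by
  have h := jordan_linearized x c c z
  rw [hc, hx, mul_comm x c, hx] at h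
  linear_combination (norm := abel) h

theorem commute_of_mul_eq_zero {c x : J} (hc : c * c = c) (hx : c * x = 0) (z : J) :
    c * (x * z) = x * (c * z) := by
  have h := jordan_linearized x c c z
  rw [hc, hx, mul_comm x c, hx] at h
  simp only [zero_mul, mul_zero, add_zero] at h
  exact h.symm

/-- The Peirce spaces `V₁(c)` and `V₀(c)` annihilate each other. -/
theorem mul_eq_zero_of_peirce {c x y : J} (hc : c * c = c) (hx : c * x = x) (hy : c * y = 0) :
    x * y = 0 := by
  have h1 := commute_of_mul_eq_self hc hx y
  have h2 := commute_of_mul_eq_zero hc hy x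
  rw [hy, mul_zero] at h1
  rw [hx, mul_comm y x, h1] at h2
  exact h2.symm

/-- The Peirce polynomial: `2 L(c)³ = 3 L(c)² - L(c)` for an idempotent `c`. -/
theorem peirce_cubic {c : J} (hc : c * c = c) (z : J) :
    (2 : ℝ) • (c * (c * (c * z))) = (3 : ℝ) • (c * (c * z)) - c * z := by
  have h := jordan_mul_triple c c c z
  simp only [hc] at h
  linear_combination (norm := module) h

theorem mul_quadRep_of_idempotent [SMulCommClass ℝ J J] {c : J} (hc : c * c = c) (z : J) :
    c * quadRep c z = quadRep c z := by
  have h := peirce_cubic hc z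
  rw [quadRep_apply, hc, mul_sub, mul_smul_comm]
  linear_combination (norm := module) h

end Peirce

/-- A decomposition of an idempotent into two idempotents is orthogonal. -/
theorem mul_eq_zero_of_idempotent_add {J : Type*} [NonAssocCommRing J] [Module ℝ J] {u v : J}
    (hu : u * u = u) (hv : v * v = v) (h : (u + v) * (u + v) = u + v) : u * v = 0 := by
  have h2 : (2 : ℝ) • (u * v) = 0 := by
    rw [add_mul, mul_add, mul_add, hu, hv, mul_comm v u] at h
    linear_combination (norm := module) h
  exact (smul_eq_zero.mp h2).resolve_left two_ne_zero

section Inner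

variable {J : Type*} [NonAssocCommRing J] [Module ℝ J] {φ : LinearMap.BilinForm ℝ J}

theorem IsAssocInner.nonneg (hφ : IsAssocInner φ) (x : J) : 0 ≤ φ x x := by
  rcases eq_or_ne x 0 with rfl | h
  · simp
  · exact (hφ.pos x h).le

theorem IsAssocInner.mul_self_eq_zero (hφ : IsAssocInner φ) {x : J} (h : x * x = 0) : x = 0 := by
  by_contra hx
  have h1 := hφ.assoc x x 1
  rw [h, mul_one, map_zero, LinearMap.zero_apply] at h1
  exact (hφ.pos x hx).ne h1

theorem IsAssocInner.apply_one_right (hφ : IsAssocInner φ) {c : J} (hc : c * c = c) :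
    φ c 1 = φ c c := by
  conv_lhs => rw [← hc]
  rw [hφ.assoc, mul_one]

/-- The cone of squares pairs nonnegatively with idempotents: `L(c)` is positive semidefinite, since
`L(c) = P₁ + P_{1/2} / 2` with the Peirce projections `P₁ = 2 L(c)² - L(c)` and
`P_{1/2} = 4 L(c) - 4 L(c)²`. -/
theorem IsAssocInner.idempotent_sq_nonneg [IsCommJordan J] (hφ : IsAssocInner φ) {c : J}
    (hc : c * c = c) (u : J) : 0 ≤ φ c (u * u) := by
  have hA : φ c (u * u) = φ (c * u) u := by rw [mul_comm c u, hφ.assoc]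
  have hB := hφ.assoc c (c * u) u
  have hC := hφ.assoc c (c * (c * u)) u
  have hD := hφ.assoc c (c * (c * u)) (c * u)
  have h1 := congrArg (fun z => φ z u) (peirce_cubic hc u)
  have h2 := congrArg (fun z => φ z (c * u)) (peirce_cubic hc u)
  have h3 := hφ.nonneg ((2 : ℝ) • (c * (c * u)) - c * u)
  have h4 := hφ.nonneg (c * u - c * (c * u))
  have h5 := hφ.symm (c * u) (c * (c * u))
  simp only [map_smul, map_sub, LinearMap.smul_apply, LinearMap.sub_apply, smul_eq_mul]
    at h1 h2 h3 h4
  rw [hA]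
  linarith

variable [SMulCommClass ℝ J J]

theorem IsAssocInner.quadRep_symm (hφ : IsAssocInner φ) (x y z : J) :
    φ (quadRep x y) z = φ y (quadRep x z) := by
  simp only [quadRep_apply, map_smul, map_sub, LinearMap.smul_apply, LinearMap.sub_apply,
    hφ.assoc]

end Inner

/-! ### Spectral decompositions -/

theorem iSup_eigenspace_eq_top {V : Type*} [AddCommGroup V] [Module ℝ V] [FiniteDimensional ℝ V]
    (φ : LinearMap.BilinForm ℝ V) (hsymm : ∀ x y, φ x y = φ y x) (hpos : ∀ x, x ≠ 0 → 0 < φ x x)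
    (T : Module.End ℝ V) (hT : ∀ x y, φ (T x) y = φ x (T y)) :
    ⨆ μ, Module.End.eigenspace T μ = ⊤ := by
  let core : InnerProductSpace.Core ℝ V :=
    { inner := fun x y => φ x y
      conj_inner_symm := fun x y => by simpa using hsymm y x
      re_inner_nonneg := fun x => by
        rcases eq_or_ne x 0 with rfl | h
        · simp
        · simpa using (hpos x h).le
      add_left := fun x y z => by simp
      smul_left := fun x y r => by simp
      definite := fun x hx => by
        by_contra h
        exact (hpos x h).ne' hx }
  let : NormedAddCommGroup V := core.toNormedAddCommGroup
  let : InnerProductSpace ℝ V := InnerProductSpace.ofCore core.toCore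
  have hS : T.IsSymmetric := hT
  have h := hS.orthogonalComplement_iSup_eigenspaces_eq_bot
  rwa [Submodule.orthogonal_eq_bot_iff] at h

section Spectral

variable {J : Type*} [NonAssocCommRing J] [Module ℝ J] [IsCommJordan J]
  [IsScalarTower ℝ J J] [SMulCommClass ℝ J J] [FiniteDimensional ℝ J]
  {φ : LinearMap.BilinForm ℝ J}

/-- The spectral theorem in the Peirce space `V₁(c)`, with idempotents that need not be primitive.
The `e μ` are the components of `c` in the eigenspaces of `L(x)`, taken inside an `L(x)`-invariant
subspace of elements whose multiplications commute with `L(x)`. If `L(e μ)` commutes with `L(x)`,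
then `x (e μ * e ν)` equals both `μ (e μ * e ν)` and `ν (e μ * e ν)`. -/
theorem exists_spectral_idempotents (hφ : IsAssocInner φ) {c x : J} (hc : c * c = c)
    (hx : c * x = x) :
    ∃ (S : Finset ℝ) (e : ℝ → J), (∀ μ, e μ * e μ = e μ) ∧ (∀ μ ν, μ ≠ ν → e μ * e ν = 0) ∧
      (∀ μ, c * e μ = e μ) ∧ (∀ μ, x * e μ = μ • e μ) ∧ ∑ μ ∈ S, e μ = c := by
  let L : J → Module.End ℝ J := fun y => LinearMap.mulLeft ℝ y
  have hLadd : ∀ y z, L (y + z) = L y + L z := fun y z => by ext; simp [L, add_mul]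
  have hLsmul : ∀ (r : ℝ) y, L (r • y) = r • L y := fun r y => by
    ext z; exact smul_mul_assoc r y z
  have hL0 : L 0 = 0 := by ext; simp [L]
  let G : Set (Module.End ℝ J) := {L x, L (x * x), L c}
  let C : Subalgebra ℝ (Module.End ℝ J) := Subalgebra.centralizer ℝ G.centralizer
  have hGC : ∀ T ∈ G, T ∈ C := fun T hT => by
    rw [Subalgebra.mem_centralizer_iff]
    exact fun U hU => (hU T hT).symm
  have hxG : L x ∈ G.centralizer := by
    rintro T (rfl | rfl | rfl)
    · rfl
    · ext z
      exact IsJordan.lmul_lmul_comm_lmul x z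
    · ext z
      exact commute_of_mul_eq_self hc hx z
  let W : Submodule ℝ J :=
    { carrier := {y | L y ∈ C ∧ L (x * y) ∈ C ∧ c * y = y}
      add_mem' := by
        rintro y z ⟨hy1, hy2, hy3⟩ ⟨hz1, hz2, hz3⟩
        refine ⟨?_, ?_, ?_⟩
        · rw [hLadd]; exact add_mem hy1 hz1
        · rw [mul_add, hLadd]; exact add_mem hy2 hz2
        · rw [mul_add, hy3, hz3]
      zero_mem' := by
        refine ⟨?_, ?_, mul_zero c⟩
        · rw [hL0]; exact zero_mem C
        · rw [mul_zero, hL0]; exact zero_mem C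
      smul_mem' := by
        rintro r y ⟨hy1, hy2, hy3⟩
        refine ⟨?_, ?_, ?_⟩
        · rw [hLsmul]; exact C.smul_mem hy1 r
        · rw [mul_smul_comm, hLsmul]; exact C.smul_mem hy2 r
        · rw [mul_smul_comm, hy3] }
  have hWcomm : ∀ y ∈ W, ∀ z, x * (y * z) = y * (x * z) := fun y hy z => by
    have h := (Subalgebra.mem_centralizer_iff ℝ).mp hy.1 (L x) hxG
    exact LinearMap.congr_fun h z
  have hWinv : ∀ y ∈ W, L x y ∈ W := by
    rintro y ⟨hy1, hy2, hy3⟩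
    refine ⟨hy2, ?_, ?_⟩
    · have hE : L (x * (x * y)) = L (x * x) * L y + L (x * y) * L x + L (x * y) * L x -
          L y * (L x * L x) - L x * (L x * L y) := by
        ext z
        have h := jordan_mul_triple y x x z
        rw [mul_comm y x] at h
        exact h
      have hx1 : L x ∈ C := hGC _ (by simp [G])
      have hx2 : L (x * x) ∈ C := hGC _ (by simp [G])
      change L (x * (x * y)) ∈ C
      rw [hE]
      exact sub_mem (sub_mem (add_mem (add_mem (mul_mem hx2 hy1) (mul_mem hy2 hx1))
        (mul_mem hy2 hx1)) (mul_mem hy1 (mul_mem hx1 hx1))) (mul_mem hx1 (mul_mem hx1 hy1))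
    · change c * (x * y) = x * y
      rw [commute_of_mul_eq_self hc hx, hy3]
  have hcW : c ∈ W := by
    refine ⟨hGC _ (by simp [G]), ?_, hc⟩
    rw [mul_comm x c, hx]
    exact hGC _ (by simp [G])
  let T : Module.End ℝ W := (L x).restrict hWinv
  have hT := iSup_eigenspace_eq_top (φ.restrict W) (fun y z => hφ.symm y z)
    (fun y hy => hφ.pos y (fun h => hy (Subtype.ext h))) T (fun y z => hφ.assoc x y z)
  have hmem : (⟨c, hcW⟩ : W) ∈ ⨆ μ, Module.End.eigenspace T μ := hT ▸ Submodule.mem_top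
  obtain ⟨f, hf, hsum⟩ := (Submodule.mem_iSup_iff_exists_finsupp _ _).mp hmem
  have heig : ∀ μ, x * (f μ : J) = μ • (f μ : J) := fun μ =>
    congrArg Subtype.val (Module.End.mem_eigenspace_iff.mp (hf μ))
  have hsum' : ∑ μ ∈ f.support, (f μ : J) = c := by
    have := congrArg Subtype.val hsum
    simpa [Finsupp.sum] using this
  have horth : ∀ μ ν, μ ≠ ν → (f μ : J) * (f ν : J) = 0 := fun μ ν hμν => by
    have h1 := hWcomm _ (f μ).2 (f ν)
    have h2 := hWcomm _ (f ν).2 (f μ)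
    rw [heig, mul_smul_comm] at h1 h2
    rw [mul_comm (f ν : J) (f μ), h1] at h2
    have h3 : (ν - μ) • ((f μ : J) * (f ν : J)) = 0 := by rw [sub_smul, h2, sub_self]
    exact (smul_eq_zero.mp h3).resolve_left (sub_ne_zero.mpr hμν.symm)
  refine ⟨f.support, fun μ => (f μ : J), fun μ => ?_, horth, fun μ => (f μ).2.2.2, heig, hsum'⟩
  have h : (f μ : J) * c = f μ := by rw [mul_comm]; exact (f μ).2.2.2
  calc (f μ : J) * f μ = ∑ ν ∈ f.support, (f μ : J) * f ν := by
        symm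
        refine Finset.sum_eq_single μ (fun ν _ hν => horth μ ν hν.symm) (fun hμ => ?_)
        rw [Finsupp.notMem_support_iff.mp hμ]
        simp
    _ = f μ := by rw [← Finset.mul_sum, hsum', h]

end Spectral

/-! ### Refinement to Jordan frames -/

section Frame

variable {J : Type*} [NonAssocCommRing J] [Module ℝ J]

/-- A finite set of nonzero pairwise orthogonal idempotents with sum `1`, each of which is an
eigenvector of `L(x)`: a spectral decomposition of `x`, except that the idempotents need not be
primitive. -/
structure IsSpectralSystem (x : J) (S : Finset J) : Prop where
  ne_zero : ∀ c ∈ S, c ≠ 0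
  idem : ∀ c ∈ S, c * c = c
  eigen : ∀ c ∈ S, ∃ l : ℝ, x * c = l • c
  orth : ∀ c ∈ S, ∀ d ∈ S, c ≠ d → c * d = 0
  sum_eq_one : ∑ c ∈ S, c = 1

section Existence

variable [IsCommJordan J] [IsScalarTower ℝ J J] [SMulCommClass ℝ J J] [FiniteDimensional ℝ J]
  {φ : LinearMap.BilinForm ℝ J}

omit [IsCommJordan J] [IsScalarTower ℝ J J] in
theorem IsSpectralSystem.card_le {x : J} {S : Finset J} (h : IsSpectralSystem x S) :
    S.card ≤ Module.finrank ℝ J := by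
  have hli : LinearIndependent ℝ (fun c : S => (c : J)) := by
    rw [Fintype.linearIndependent_iff]
    intro g hg c
    have h1 := congrArg (fun y => (c : J) * y) hg
    simp only [Finset.mul_sum, mul_zero] at h1
    rw [Finset.sum_eq_single c] at h1
    · rw [mul_smul_comm, h.idem c c.2] at h1
      exact (smul_eq_zero.mp h1).resolve_right (h.ne_zero c c.2)
    · intro d _ hd
      rw [mul_smul_comm, h.orth c c.2 d d.2 (fun hcd => hd (Subtype.ext hcd.symm)), smul_zero]
    · simp
  simpa using hli.fintype_card_le_finrank

theorem exists_isSpectralSystem (hφ : IsAssocInner φ) (x : J) :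
    ∃ S : Finset J, IsSpectralSystem x S := by
  classical
  obtain ⟨S, e, hidem, horth, -, heig, hsum⟩ :=
    exists_spectral_idempotents hφ (mul_one (1 : J)) (one_mul x)
  have hinj : ∀ μ ν, e μ ≠ 0 → e μ = e ν → μ = ν := fun μ ν h0 h => by
    by_contra hne
    apply h0
    rw [← hidem μ]
    nth_rewrite 2 [h]
    exact horth μ ν hne
  refine ⟨{μ ∈ S | e μ ≠ 0}.image e, ?_, ?_, ?_, ?_, ?_⟩
  · simp only [Finset.mem_image, Finset.mem_filter]
    rintro _ ⟨μ, ⟨_, h⟩, rfl⟩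
    exact h
  · simp only [Finset.mem_image]
    rintro _ ⟨μ, _, rfl⟩
    exact hidem μ
  · simp only [Finset.mem_image]
    rintro _ ⟨μ, _, rfl⟩
    exact ⟨μ, heig μ⟩
  · simp only [Finset.mem_image]
    rintro _ ⟨μ, _, rfl⟩ _ ⟨ν, _, rfl⟩ h
    exact horth μ ν (fun hμν => h (congrArg e hμν))
  · rw [Finset.sum_image, Finset.sum_filter_ne_zero, hsum]
    intro μ hμ ν _ h
    exact hinj μ ν (by simpa using (Finset.mem_filter.mp hμ).2) h

omit [SMulCommClass ℝ J J] [FiniteDimensional ℝ J] in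
/-- Splitting an idempotent that is not primitive enlarges a spectral system. -/
theorem IsSpectralSystem.exists_card_lt {x : J} {S : Finset J} (h : IsSpectralSystem x S) {c : J}
    (hc : c ∈ S) (hprim : ¬ IsPrimitiveIdempotent c) :
    ∃ S' : Finset J, IsSpectralSystem x S' ∧ S.card < S'.card := by
  classical
  obtain ⟨u, v, hu0, hv0, hu, hv, huv⟩ : ∃ u v : J, u ≠ 0 ∧ v ≠ 0 ∧ u * u = u ∧ v * v = v ∧
      c = u + v := by
    by_contra hcon
    exact hprim ⟨h.ne_zero c hc, h.idem c hc, hcon⟩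
  have hcc := h.idem c hc
  have h0 : u * v = 0 := mul_eq_zero_of_idempotent_add hu hv (huv ▸ hcc)
  have hcu : c * u = u := by rw [huv, add_mul, hu, mul_comm v u, h0, add_zero]
  have hcv : c * v = v := by rw [huv, add_mul, hv, h0, zero_add]
  have hort : ∀ w, c * w = w → ∀ d ∈ S, d ≠ c → w * d = 0 := fun w hw d hd hdc =>
    mul_eq_zero_of_peirce hcc hw (h.orth c hc d hd hdc.symm)
  have hnot : ∀ w, w ≠ 0 → w * w = w → c * w = w → w ∉ S.erase c := fun w hw0 hww hcw hw => by
    have hw' := Finset.mem_erase.mp hw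
    exact hw0 (hww ▸ hort w hcw w hw'.2 hw'.1)
  have heig : ∀ w, c * w = w → ∃ l : ℝ, x * w = l • w := fun w hw => by
    obtain ⟨l, hl⟩ := h.eigen c hc
    refine ⟨l, ?_⟩
    have hx : x = ∑ d ∈ S, x * d := by rw [← Finset.mul_sum, h.sum_eq_one, mul_one]
    conv_lhs => rw [hx, Finset.sum_mul]
    rw [Finset.sum_eq_single_of_mem c hc, hl, smul_mul_assoc, hw]
    intro d hd hdc
    obtain ⟨l', hl'⟩ := h.eigen d hd
    rw [hl', smul_mul_assoc, mul_comm, hort w hw d hd hdc, smul_zero]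
  have hvS := hnot v hv0 hv hcv
  have huS : u ∉ insert v (S.erase c) := by
    rw [Finset.mem_insert, not_or]
    refine ⟨fun huv' => hu0 ?_, hnot u hu0 hu hcu⟩
    rw [← hu]
    nth_rewrite 2 [huv']
    exact h0
  refine ⟨insert u (insert v (S.erase c)), ⟨?_, ?_, ?_, ?_, ?_⟩, ?_⟩
  · simp only [Finset.mem_insert, Finset.mem_erase]
    rintro d (rfl | rfl | ⟨-, hd⟩)
    exacts [hu0, hv0, h.ne_zero d hd]
  · simp only [Finset.mem_insert, Finset.mem_erase]
    rintro d (rfl | rfl | ⟨-, hd⟩)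
    exacts [hu, hv, h.idem d hd]
  · simp only [Finset.mem_insert, Finset.mem_erase]
    rintro d (rfl | rfl | ⟨-, hd⟩)
    exacts [heig _ hcu, heig _ hcv, h.eigen d hd]
  · simp only [Finset.mem_insert, Finset.mem_erase]
    rintro d (rfl | rfl | ⟨hdc, hd⟩) d' (rfl | rfl | ⟨hdc', hd'⟩) hne
    · exact absurd rfl hne
    · exact h0
    · exact hort _ hcu d' hd' hdc'
    · rw [mul_comm]; exact h0
    · exact absurd rfl hne
    · exact hort _ hcv d' hd' hdc'
    · rw [mul_comm]; exact hort _ hcu d hd hdc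
    · rw [mul_comm]; exact hort _ hcv d hd hdc
    · exact h.orth d hd d' hd' hne
  · rw [Finset.sum_insert huS, Finset.sum_insert hvS, ← add_assoc, ← huv]
    exact (Finset.add_sum_erase S (fun d => d) hc).trans h.sum_eq_one
  · rw [Finset.card_insert_of_notMem huS, Finset.card_insert_of_notMem hvS,
      Finset.card_erase_of_mem hc]
    have := Finset.card_pos.mpr ⟨c, hc⟩
    omega

theorem IsSpectralSystem.exists_primitive {x : J} {S : Finset J} (h : IsSpectralSystem x S) :
    ∃ S' : Finset J, IsSpectralSystem x S' ∧ ∀ c ∈ S', IsPrimitiveIdempotent c := by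
  induction hk : Module.finrank ℝ J - S.card using Nat.strong_induction_on generalizing S with
  | _ k ih =>
    by_cases hall : ∀ c ∈ S, IsPrimitiveIdempotent c
    · exact ⟨S, h, hall⟩
    · push Not at hall
      obtain ⟨c, hc, hprim⟩ := hall
      obtain ⟨S', hS', hlt⟩ := h.exists_card_lt hc hprim
      have := hS'.card_le
      exact ih _ (by omega) hS' rfl

/-- The spectral theorem for Euclidean Jordan algebras. -/
theorem nonempty_spectralDecomposition (hφ : IsAssocInner φ) (x : J) :
    Nonempty (SpectralDecomposition x) := by
  obtain ⟨S₀, h₀⟩ := exists_isSpectralSystem hφ x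
  obtain ⟨S, h, hprim⟩ := h₀.exists_primitive
  choose l hl using fun c : S => h.eigen c c.2
  let σ := S.equivFin.symm
  have hsum : ∑ i, (σ i : J) = 1 := by
    rw [Equiv.sum_comp σ (fun c : S => (c : J)), Finset.sum_coe_sort S (fun c => c), h.sum_eq_one]
  refine ⟨⟨S.card, fun i => σ i, fun i => l (σ i), ⟨fun i => hprim _ (σ i).2, fun i j => ?_, hsum⟩,
    ?_⟩⟩
  · refine ⟨?_, fun hij => h.orth _ (σ i).2 _ (σ j).2 (fun he => hij (σ.injective
      (Subtype.ext he)))⟩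
    rintro h0 rfl
    rw [h.idem _ (σ i).2] at h0
    exact h.ne_zero _ (σ i).2 h0
  · simp only [← hl]
    rw [← Finset.mul_sum, hsum, mul_one]

/-- The Peirce space `V₁(c)` of a primitive idempotent `c` is the line through `c`. -/
theorem exists_eq_smul_of_primitive (hφ : IsAssocInner φ) {c x : J}
    (hc : IsPrimitiveIdempotent c) (hx : c * x = x) : ∃ s : ℝ, x = s • c := by
  obtain ⟨S, e, hidem, horth, hce, heig, hsum⟩ := exists_spectral_idempotents hφ hc.2.1 hx
  obtain ⟨μ, -, hμ⟩ : ∃ μ ∈ S, e μ ≠ 0 := by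
    by_contra! hcon
    exact hc.1 (hsum ▸ Finset.sum_eq_zero hcon)
  have hcμ : c = e μ := by
    by_contra hne
    refine hc.2.2 ⟨e μ, c - e μ, hμ, sub_ne_zero.mpr hne, hidem μ, ?_, by abel⟩
    rw [sub_mul, mul_sub, mul_sub, hc.2.1, hce, mul_comm _ c, hce, hidem]
    abel
  refine ⟨μ, ?_⟩
  have h := heig μ
  rwa [← hcμ, mul_comm, hx] at h

theorem quadRep_of_primitive (hφ : IsAssocInner φ) {c : J} (hc : IsPrimitiveIdempotent c) (z : J) :
    quadRep c z = (φ c z / φ c c) • c := by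
  obtain ⟨s, hs⟩ := exists_eq_smul_of_primitive hφ hc (mul_quadRep_of_idempotent hc.2.1 z)
  have h := hφ.quadRep_symm c z c
  have hcc : quadRep c c = c := by
    rw [quadRep_apply, hc.2.1, hc.2.1, two_smul, add_sub_cancel_right]
  rw [hs, hcc, map_smul, LinearMap.smul_apply, smul_eq_mul, hφ.symm z c] at h
  rw [hs, ← h, mul_div_cancel_right₀ _ (hφ.pos c hc.1).ne']

/-! ### Linearity of the trace -/

/-- Primitive idempotents that are not orthogonal have the same length: with `P(c)d = s c` and
`P(d)c = t d`, the fundamental formula `P(P(c)d) = P(c)P(d)P(c)` gives `s² = s t`. -/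
theorem inner_self_eq_of_primitive (hφ : IsAssocInner φ) {c d : J} (hc : IsPrimitiveIdempotent c)
    (hd : IsPrimitiveIdempotent d) (hcd : φ c d ≠ 0) : φ c c = φ d d := by
  have hNc := (hφ.pos c hc.1).ne'
  have hNd := (hφ.pos d hd.1).ne'
  have h := quadRep_quadRep c d 1
  rw [quadRep_one_right, quadRep_one_right, hc.2.1, quadRep_of_primitive hφ hd c, map_smul,
    quadRep_of_primitive hφ hc d, smul_mul_smul_comm, hc.2.1, smul_smul] at h
  have h2 := smul_left_injective ℝ hc.1 h
  simp only [hφ.symm d c] at h2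
  field_simp at h2
  exact h2.symm

end Existence

variable [IsScalarTower ℝ J J] [SMulCommClass ℝ J J] {r : ℕ} {c : Fin r → J}

omit [SMulCommClass ℝ J J] in
theorem IsJordanFrame.sum_mul (hc : IsJordanFrame c) (f : Fin r → ℝ) (j : Fin r) :
    (∑ i, f i • c i) * c j = f j • c j := by
  rw [Finset.sum_mul, Finset.sum_eq_single j]
  · rw [smul_mul_assoc, (hc.primitive j).2.1]
  · intro i _ hij
    rw [smul_mul_assoc, (hc.mul_eq_zero_iff i j).mpr hij, smul_zero]
  · simp

theorem IsJordanFrame.sum_mul_sum (hc : IsJordanFrame c) (f g : Fin r → ℝ) :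
    (∑ i, f i • c i) * (∑ i, g i • c i) = ∑ i, (f i * g i) • c i := by
  rw [Finset.mul_sum]
  refine Finset.sum_congr rfl fun j _ => ?_
  rw [mul_smul_comm, hc.sum_mul, smul_smul, mul_comm]

theorem IsJordanFrame.quadRep_sum (hc : IsJordanFrame c) (f g : Fin r → ℝ) :
    quadRep (∑ i, f i • c i) (∑ i, g i • c i) = ∑ i, (f i * f i * g i) • c i := by
  rw [quadRep_apply, hc.sum_mul_sum, hc.sum_mul_sum, hc.sum_mul_sum, hc.sum_mul_sum,
    Finset.smul_sum, ← Finset.sum_sub_distrib]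
  refine Finset.sum_congr rfl fun j _ => ?_
  rw [smul_smul, ← sub_smul]
  congr 1
  ring

section Trace

variable [IsCommJordan J] [FiniteDimensional ℝ J] {φ : LinearMap.BilinForm ℝ J}

theorem IsJordanFrame.inner_dual (hφ : IsAssocInner φ) (hc : IsJordanFrame c) {d : J}
    (hd : IsPrimitiveIdempotent d) : φ d (∑ i, (φ (c i) (c i))⁻¹ • c i) = 1 := by
  have h : ∀ i, (φ (c i) (c i))⁻¹ * φ d (c i) = (φ d d)⁻¹ * φ d (c i) := fun i => by
    rcases eq_or_ne (φ d (c i)) 0 with h0 | h0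
    · rw [h0, mul_zero, mul_zero]
    · rw [inner_self_eq_of_primitive hφ hd (hc.primitive i) h0]
  simp only [map_sum, map_smul, smul_eq_mul, h]
  rw [← Finset.mul_sum, ← map_sum, hc.sum_eq_one, hφ.apply_one_right hd.2.1,
    inv_mul_cancel₀ (hφ.pos d hd.1).ne']

/-- The trace is the pairing with `∑ cᵢ / φ(cᵢ, cᵢ)`, for any Jordan frame `c`. In particular it is
linear. -/
theorem IsJordanFrame.trace_eq (hφ : IsAssocInner φ) (hc : IsJordanFrame c) (y : J) :
    trace y = φ y (∑ i, (φ (c i) (c i))⁻¹ • c i) := by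
  have hy := nonempty_spectralDecomposition hφ y
  rw [trace, dif_pos hy]
  have hq := fun i => hc.inner_dual hφ (hy.some.isJordanFrame.primitive i)
  generalize ∑ i, (φ (c i) (c i))⁻¹ • c i = q at hq ⊢
  conv_rhs => rw [hy.some.eq_sum, map_sum, LinearMap.sum_apply]
  refine Finset.sum_congr rfl fun i _ => ?_
  rw [map_smul, LinearMap.smul_apply, hq, smul_eq_mul, mul_one]

theorem exists_trace_eq (hφ : IsAssocInner φ) : ∃ q : J, ∀ y, trace y = φ y q :=
  ⟨_, (nonempty_spectralDecomposition hφ (0 : J)).some.isJordanFrame.trace_eq hφ⟩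

end Trace

end Frame

/-! ### Strictly positive elements -/

section Positive

variable {J : Type*} [NonAssocCommRing J] [Module ℝ J]

/-- An element is strictly positive (with respect to `φ`) if it pairs positively with all primitive
idempotents; this is the form in which membership in the interior of the cone of squares is used. -/
def StrictPos (φ : LinearMap.BilinForm ℝ J) (x : J) : Prop :=
  ∀ c, IsPrimitiveIdempotent c → 0 < φ x c

variable [IsCommJordan J] {φ : LinearMap.BilinForm ℝ J}

theorem strictPos_of_mem_interior [TopologicalSpace J] [IsTopologicalAddGroup J]
    [ContinuousSMul ℝ J] (hφ : IsAssocInner φ) {x : J} (hx : x ∈ interior (coneOfSquares J)) :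
    StrictPos φ x := by
  intro c hc
  have hcont : Continuous (fun t : ℝ => x - t • (1 : J)) := by fun_prop
  have hev : ∀ᶠ t in nhds (0 : ℝ), x - t • (1 : J) ∈ coneOfSquares J := by
    refine hcont.continuousAt.eventually_mem ?_
    simpa using mem_interior_iff_mem_nhds.mp hx
  obtain ⟨t, ⟨y, hy⟩, ht⟩ :=
    ((hev.filter_mono nhdsWithin_le_nhds).and (self_mem_nhdsWithin (s := Set.Ioi 0))).exists
  have hxe : x = y * y + t • (1 : J) := by rw [← hy]; abel
  have h1 := hφ.idempotent_sq_nonneg hc.2.1 y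
  have h2 : φ 1 c = φ c c := by rw [hφ.symm, hφ.apply_one_right hc.2.1]
  rw [hxe, map_add, map_smul, LinearMap.add_apply, LinearMap.smul_apply, smul_eq_mul,
    hφ.symm (y * y), h2]
  exact add_pos_of_nonneg_of_pos h1 (mul_pos ht (hφ.pos c hc.1))

theorem IsJordanFrame.inner_idempotent_pos (hφ : IsAssocInner φ) {r : ℕ} {c : Fin r → J}
    (hc : IsJordanFrame c) {f : Fin r → ℝ} (hf : ∀ i, 0 < f i) {d : J} (hd : d * d = d)
    (hd0 : d ≠ 0) : 0 < φ (∑ i, f i • c i) d := by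
  have hnn : ∀ i, 0 ≤ φ (c i) d := fun i => by
    have h := hφ.idempotent_sq_nonneg (hc.primitive i).2.1 d
    rwa [hd] at h
  have hsum : ∑ i, φ (c i) d = φ d d := by
    rw [← hφ.apply_one_right hd, hφ.symm, ← hc.sum_eq_one, map_sum, LinearMap.sum_apply]
  simp only [map_sum, map_smul, LinearMap.sum_apply, LinearMap.smul_apply, smul_eq_mul]
  refine Finset.sum_pos' (fun i _ => mul_nonneg (hf i).le (hnn i)) ?_
  by_contra! hcon
  have h0 : ∀ i, φ (c i) d = 0 := fun i => by
    refine le_antisymm ?_ (hnn i)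
    by_contra! hpos
    exact (mul_pos (hf i) hpos).not_ge (hcon i (Finset.mem_univ i))
  simp only [h0, Finset.sum_const_zero] at hsum
  exact (hφ.pos d hd0).ne hsum

variable [IsScalarTower ℝ J J] [SMulCommClass ℝ J J] [FiniteDimensional ℝ J]

/-- A strictly positive element is a positive combination of a Jordan frame, and its powers are the
expected combinations of the same frame. -/
theorem StrictPos.exists_frame (hφ : IsAssocInner φ) {x : J} (hx : StrictPos φ x) :
    ∃ (r : ℕ) (c : Fin r → J) (f : Fin r → ℝ), IsJordanFrame c ∧ (∀ i, 0 < f i) ∧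
      x = ∑ i, f i • c i ∧ ∀ p, power x p = ∑ i, (f i ^ p) • c i := by
  have hs := nonempty_spectralDecomposition hφ x
  have hc := hs.some.isJordanFrame
  refine ⟨_, hs.some.frame, hs.some.eigenvalue, hc, fun i => ?_, hs.some.eq_sum, fun p => ?_⟩
  · have hci := hc.primitive i
    have hxc := hc.sum_mul hs.some.eigenvalue i
    rw [← hs.some.eq_sum] at hxc
    have h := hφ.assoc (hs.some.frame i) x (hs.some.frame i)
    rw [hci.2.1, mul_comm (hs.some.frame i) x, hxc, map_smul, LinearMap.smul_apply,
      smul_eq_mul] at h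
    replace h := h.trans_gt (hx _ hci)
    exact pos_of_mul_pos_left h (hφ.nonneg _)
  · rw [power, dif_pos hs]

omit [FiniteDimensional ℝ J] in
theorem IsJordanFrame.quadRep_injective {r : ℕ} {c : Fin r → J} (hc : IsJordanFrame c)
    {f : Fin r → ℝ} (hf : ∀ i, 0 < f i) : Function.Injective (quadRep (∑ i, f i • c i)) := by
  have h1 : quadRep (∑ i, f i • c i) (∑ i, (f i * f i)⁻¹ • c i) = 1 := by
    rw [hc.quadRep_sum, ← hc.sum_eq_one]
    refine Finset.sum_congr rfl fun i _ => ?_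
    rw [mul_inv_cancel₀ (mul_pos (hf i) (hf i)).ne', one_smul]
  have hl : ∀ z, quadRep (∑ i, f i • c i) (quadRep (∑ i, (f i * f i)⁻¹ • c i)
      (quadRep (∑ i, f i • c i) z)) = z := fun z => by
    rw [← quadRep_quadRep, h1, quadRep_one_left]
  intro y z hyz
  rw [← hl y, hyz, hl z]

omit [IsScalarTower ℝ J J] [FiniteDimensional ℝ J] in
/-- If `P(x)` is injective and `P(x)y = x`, i.e. `y` is the inverse of `x`, then `P(y)` inverts
`P(x)`. -/
theorem quadRep_quadRep_cancel {x y : J} (hx : Function.Injective (quadRep x))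
    (hxy : quadRep x y = x) (z : J) : quadRep y (quadRep x z) = z := by
  apply hx
  rw [← quadRep_quadRep, hxy]

/-- `P(s)` maps a primitive idempotent `c` to a positive multiple of an idempotent: by the
fundamental formula `P(P(s)c) = P(s)P(c)P(s)` has rank one, and its value at `1` is a multiple of
`P(s)c`. -/
theorem exists_quadRep_primitive_eq_smul (hφ : IsAssocInner φ) {s c : J}
    (hs : Function.Injective (quadRep s)) (hc : IsPrimitiveIdempotent c) :
    ∃ (t : ℝ) (d : J), 0 < t ∧ d * d = d ∧ d ≠ 0 ∧ quadRep s c = t • d := by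
  have hz0 : quadRep s c ≠ 0 := fun h => hc.1 (hs (by rw [h, map_zero]))
  have hzz : quadRep s c * quadRep s c = (φ c (s * s) / φ c c) • quadRep s c := by
    rw [← quadRep_one_right (quadRep s c), quadRep_quadRep, quadRep_one_right,
      quadRep_of_primitive hφ hc, map_smul]
  have ht : 0 ≤ φ c (s * s) / φ c c :=
    div_nonneg (hφ.idempotent_sq_nonneg hc.2.1 s) (hφ.nonneg c)
  generalize φ c (s * s) / φ c c = t at hzz ht
  have ht0 : t ≠ 0 := by
    rintro rfl
    rw [zero_smul] at hzz
    exact hz0 (hφ.mul_self_eq_zero hzz)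
  refine ⟨t, t⁻¹ • quadRep s c, lt_of_le_of_ne ht ht0.symm, ?_,
    smul_ne_zero (inv_ne_zero ht0) hz0, by rw [smul_inv_smul₀ ht0]⟩
  rw [smul_mul_smul_comm, hzz, smul_smul, mul_assoc, inv_mul_cancel₀ ht0, mul_one]

theorem StrictPos.quadRep (hφ : IsAssocInner φ) {s v : J} (hs : Function.Injective (quadRep s))
    (hv : StrictPos φ v) : StrictPos φ (quadRep s v) := by
  intro c hc
  obtain ⟨t, d, ht, hd, hd0, h⟩ := exists_quadRep_primitive_eq_smul hφ hs hc
  obtain ⟨r, e, f, he, hf, rfl, -⟩ := hv.exists_frame hφ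
  rw [hφ.quadRep_symm, h, map_smul, smul_eq_mul]
  exact mul_pos ht (he.inner_idempotent_pos hφ hf hd hd0)

/-- The defining property of the geometric mean `g = a # w⁻¹`: it solves `P(g)w = a`. -/
theorem quadRep_geomMean (hφ : IsAssocInner φ) {a w : J} (ha : StrictPos φ a)
    (hw : StrictPos φ w) :
    Function.Injective (quadRep (geomMean a (power w (-1)))) ∧
      quadRep (geomMean a (power w (-1))) w = a := by
  obtain ⟨_, c, f, hc, hf, haf, hpa⟩ := ha.exists_frame hφ
  obtain ⟨_, e, l, he, hl, hwl, hpw⟩ := hw.exists_frame hφ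
  have hr : Function.Injective (quadRep (power a (1 / 2))) := by
    rw [hpa]
    exact hc.quadRep_injective fun i => Real.rpow_pos_of_pos (hf i) _
  have hs : Function.Injective (quadRep (power a (-1 / 2))) := by
    rw [hpa]
    exact hc.quadRep_injective fun i => Real.rpow_pos_of_pos (hf i) _
  have hrr : power a (1 / 2) * power a (1 / 2) = a := by
    conv_rhs => rw [haf]
    rw [hpa, hc.sum_mul_sum]
    refine Finset.sum_congr rfl fun i _ => ?_
    rw [← Real.rpow_add (hf i)]
    norm_num
  have hrs : quadRep (power a (1 / 2)) (power a (-1 / 2)) = power a (1 / 2) := by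
    rw [hpa, hpa, hc.quadRep_sum]
    refine Finset.sum_congr rfl fun i _ => ?_
    rw [← Real.rpow_add (hf i), ← Real.rpow_add (hf i)]
    norm_num
  have hvw : quadRep (power w (-1)) w = power w (-1) := by
    conv_lhs => arg 2; rw [hwl]
    rw [hpw, he.quadRep_sum]
    refine Finset.sum_congr rfl fun i _ => ?_
    rw [Real.rpow_neg_one, mul_assoc, inv_mul_cancel₀ (hl i).ne', mul_one]
  have hv : StrictPos φ (power w (-1)) := by
    intro d hd
    rw [hpw]
    exact he.inner_idempotent_pos hφ (fun i => Real.rpow_pos_of_pos (hl i) _) hd.2.1 hd.1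
  obtain ⟨_, u, k, hu, hk, hhk, hph⟩ := (hv.quadRep hφ hs).exists_frame hφ
  rw [geomMean]
  generalize power a (1 / 2) = x at *
  generalize power a (-1 / 2) = y at *
  generalize power w (-1) = v at *
  have hm : Function.Injective (quadRep (power (quadRep y v) (1 / 2))) := by
    rw [hph]
    exact hu.quadRep_injective fun i => Real.rpow_pos_of_pos (hk i) _
  have hmm : power (quadRep y v) (1 / 2) * power (quadRep y v) (1 / 2) = quadRep y v := by
    rw [hph, hu.sum_mul_sum, hhk]
    refine Finset.sum_congr rfl fun i _ => ?_
    rw [← Real.rpow_add (hk i)]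
    norm_num
  generalize power (quadRep y v) (1 / 2) = m at *
  -- `P(x)w` is the inverse of `P(y)v = m²`
  have hone : quadRep m (quadRep x w) = 1 := by
    apply hm
    rw [← quadRep_mul_self, hmm, quadRep_quadRep, quadRep_quadRep_cancel hr hrs, hvw,
      quadRep_one_right, hmm]
  refine ⟨fun z z' h => ?_, by rw [quadRep_quadRep, hone, quadRep_one_right, hrr]⟩
  rw [quadRep_quadRep, quadRep_quadRep] at h
  exact hr (hm (hr h))

/-! ### Stationarity of fixed points -/

theorem traceInner_pos [Nontrivial J] (hφ : IsAssocInner φ) {x y : J} (hx : StrictPos φ x)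
    (hy : StrictPos φ y) : 0 < traceInner x y := by
  obtain ⟨r, c, f, hc, hf, rfl, -⟩ := hx.exists_frame hφ
  have hr : Nonempty (Fin r) := by
    by_contra hr
    have := not_nonempty_iff.mp hr
    exact one_ne_zero (hc.sum_eq_one.symm.trans (by simp))
  rw [traceInner, hc.trace_eq hφ, hφ.assoc, hc.sum_mul_sum, map_sum]
  refine Finset.sum_pos (fun i _ => ?_) Finset.univ_nonempty
  rw [map_smul, smul_eq_mul]
  have hci := hc.primitive i
  exact mul_pos (mul_pos (hf i) (inv_pos.mpr (hφ.pos _ hci.1))) (hy _ hci)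

theorem coneMapTranspose_eq_of_update_eq_self (hφ : IsAssocInner φ) {n : ℕ} {b : Fin n → J}
    (hb : ∀ j, StrictPos φ (b j)) {v : J} (hv : StrictPos φ v) {x : Fin n → ℝ}
    (h : v = update b x v) : coneMapTranspose b x = coneMapTranspose b (coneMap b v) := by
  rcases subsingleton_or_nontrivial J with _ | _
  · exact Subsingleton.elim _ _
  rcases isEmpty_or_nonempty (Fin n) with _ | _
  · exact congrArg _ (Subsingleton.elim _ _)
  have hw : StrictPos φ (coneMapTranspose b (coneMap b v)) := by
    intro c hc
    simp only [coneMapTranspose, map_sum, map_smul, LinearMap.sum_apply, LinearMap.smul_apply,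
      smul_eq_mul]
    exact Finset.sum_pos (fun j _ => mul_pos (traceInner_pos hφ (hb j) hv) (hb j c hc))
      Finset.univ_nonempty
  obtain ⟨hinj, hg⟩ := quadRep_geomMean hφ hv hw
  exact hinj (h.symm.trans hg.symm)

/-- The derivative of the squared loss in the direction `(da, db)` is
`-2 ∑ᵢ ⟨daᵢ, 𝓑ᵀXᵢ - 𝓑ᵀ𝓑aᵢ⟩ - 2 ∑ⱼ ⟨dbⱼ, 𝓐ᵀXⱼ - 𝓐ᵀ𝓐bⱼ⟩`. -/
theorem hasDerivAt_squaredLoss (hφ : IsAssocInner φ) {m n : ℕ} (X : Matrix (Fin m) (Fin n) ℝ)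
    (a : Fin m → J) (b : Fin n → J)
    (ha : ∀ i, coneMapTranspose b (fun j => X i j) = coneMapTranspose b (coneMap b (a i)))
    (hb : ∀ j, coneMapTranspose a (fun i => X i j) = coneMapTranspose a (coneMap a (b j)))
    (da : Fin m → J) (db : Fin n → J) :
    HasDerivAt (fun t : ℝ => squaredLoss X (a + t • da) (b + t • db)) 0 0 := by
  obtain ⟨q, hq⟩ := exists_trace_eq hφ
  have hτ : ∀ x y : J, traceInner x y = φ (x * y) q := fun x y => hq _
  have hexp : ∀ i j (t : ℝ), traceInner ((a + t • da) i) ((b + t • db) j) =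
      traceInner (a i) (b j) + t * (traceInner (da i) (b j) + traceInner (a i) (db j)) +
        t ^ 2 * traceInner (da i) (db j) := fun i j t => by
    simp only [hτ, Pi.add_apply, Pi.smul_apply, add_mul, mul_add, smul_mul_assoc, mul_smul_comm,
      map_add, map_smul, LinearMap.add_apply, LinearMap.smul_apply, smul_eq_mul]
    ring
  have hterm : ∀ i j, HasDerivAt
      (fun t : ℝ => (X i j - traceInner ((a + t • da) i) ((b + t • db) j)) ^ 2)
      (-2 * ((X i j - traceInner (a i) (b j)) * traceInner (da i) (b j) +
        (X i j - traceInner (a i) (b j)) * traceInner (a i) (db j))) 0 := fun i j => by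
    simp only [hexp]
    have hid := hasDerivAt_id (0 : ℝ)
    have h := ((((hid.mul_const (traceInner (da i) (b j) + traceInner (a i) (db j))).const_add
      (traceInner (a i) (b j))).add ((hid.pow 2).mul_const
        (traceInner (da i) (db j)))).const_sub (X i j)).pow 2
    refine h.congr_deriv ?_
    simp
    ring
  have hsum := HasDerivAt.fun_sum (u := Finset.univ) fun i _ =>
    HasDerivAt.fun_sum (u := Finset.univ) fun j _ => hterm i j
  refine hsum.congr_deriv ?_
  have h1 : ∀ i, ∑ j, (X i j - traceInner (a i) (b j)) * traceInner (da i) (b j) = 0 := fun i => by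
    have h := congrArg (fun z => φ (da i * z) q) (ha i)
    simp only [coneMapTranspose, coneMap, Finset.mul_sum, mul_smul_comm, map_sum, map_smul,
      LinearMap.sum_apply, LinearMap.smul_apply, smul_eq_mul] at h
    rw [← sub_eq_zero, ← Finset.sum_sub_distrib] at h
    rw [← h]
    refine Finset.sum_congr rfl fun j _ => ?_
    rw [hτ, hτ, hτ, mul_comm (b j) (a i)]
    ring
  have h2 : ∀ j, ∑ i, (X i j - traceInner (a i) (b j)) * traceInner (a i) (db j) = 0 := fun j => by
    have h := congrArg (fun z => φ (z * db j) q) (hb j)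
    simp only [coneMapTranspose, coneMap, Finset.sum_mul, smul_mul_assoc, map_sum, map_smul,
      LinearMap.sum_apply, LinearMap.smul_apply, smul_eq_mul] at h
    rw [← sub_eq_zero, ← Finset.sum_sub_distrib] at h
    rw [← h]
    refine Finset.sum_congr rfl fun i _ => ?_
    rw [hτ, hτ]
    ring
  simp only [← Finset.mul_sum, Finset.sum_add_distrib]
  rw [Finset.sum_comm (f := fun i j => (X i j - traceInner (a i) (b j)) * traceInner (a i) (db j))]
  simp [h1, h2]

end Positive

end SCMU

theorem mainTheorem2 {J : Type*} [NonAssocCommRing J] [Module ℝ J]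
    [IsScalarTower ℝ J J] [SMulCommClass ℝ J J] [FiniteDimensional ℝ J]
    [IsCommJordan J] [SCMU.IsEuclidean J]
    [TopologicalSpace J] [IsTopologicalAddGroup J] [ContinuousSMul ℝ J] [T2Space J]
    {m n : ℕ} (X : Matrix (Fin m) (Fin n) ℝ) (a : Fin m → J) (b : Fin n → J)
    (ha : ∀ i, a i ∈ interior (SCMU.coneOfSquares J))
    (hb : ∀ j, b j ∈ interior (SCMU.coneOfSquares J))
    (hfix : SCMU.IsFixedPoint X a b) :
    (∀ i, SCMU.coneMapTranspose b (fun j => X i j) =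
      SCMU.coneMapTranspose b (SCMU.coneMap b (a i))) ∧
    (∀ j, SCMU.coneMapTranspose a (fun i => X i j) =
      SCMU.coneMapTranspose a (SCMU.coneMap a (b j))) ∧
    -- the squared loss has zero derivative at `(a, b)` in every direction
    (∀ (da : Fin m → J) (db : Fin n → J),
      HasDerivAt (fun t : ℝ => SCMU.squaredLoss X (a + t • da) (b + t • db)) 0 0) := by
  obtain ⟨φ, hsymm, hpos, hassoc⟩ := SCMU.IsEuclidean.exists_assoc_inner (J := J)
  have hφ : SCMU.IsAssocInner φ := ⟨hsymm, hpos, hassoc⟩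
  have ha' := fun i => SCMU.strictPos_of_mem_interior hφ (ha i)
  have hb' := fun j => SCMU.strictPos_of_mem_interior hφ (hb j)
  have h1 := fun i => SCMU.coneMapTranspose_eq_of_update_eq_self hφ hb' (ha' i) (hfix.1 i)
  have h2 := fun j => SCMU.coneMapTranspose_eq_of_update_eq_self hφ ha' (hb' j) (hfix.2 j)
  exact ⟨h1, h2, SCMU.hasDerivAt_squaredLoss hφ X a b h1 h2⟩
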